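/- Let $k\ge 1$ and let $G$ be a finite non-empty simple graph with an edge-colouring $E(G)\to\{1,\dots,k\}$. For a vertex $v$, let $\deg_j(v)$ be the number of edges of colour $j$ incident to $v$, and let $e_j[v]$ be the number of edges of colour $j$ with both ends in the closed neighbourhood $N[v]=N(v)\cup\{v\}$. A strictly increasing sequence $(a_1,\dots,a_k)$ of positive integers is a *$k$-flip sequence* if some finite non-empty simple graph has an edge-colouring with $k$ colours such that $\deg_j(v)=a_j$ for all vertices $v$ and all $1\le j\le k$, and $e_k[v]<e_{k-1}[v]<\dots<e_1[v]$ for all vertices $v$. Call an integer $q$ with $1\le q<k$ *free for $k$* if there is an $h\in\mathbb N$ such that for every $N\in\mathbb N$ there is a $k$-flip sequence $(a_1,\dots,a_k)$ with $a_q=h$ and $a_k>N$. **Theorem 4.1.** Let $k>3$ be an integer. Then a largest index free for $k$ exists; denote it by $q(k)$. It satisfies $$\max\left\{1,\left\lceil\frac k4\right\rceil-1\right\}\le q(k),$$ and every index $q$ that is free for $k$ (in particular $q=q(k)$) satisfies $$q<\begin{cases}\dfrac k3 & \text{if } 3\mid k,\\[2mm] \left\lceil\dfrac k2\right\rceil &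 \text{otherwise.}\end{cases}$$ Moreover, for every positive integer $q$ with $q=1$ or $q<\frac k4$ there are fixed $a_1,\dots,a_q\in\mathbb N$ such that for every $N\in\mathbb N$ there is a $k$-flip sequence $(a_1,\dots,a_q,a_{q+1},\dots,a_k)$ with $a_k>N$. -/

import Mathlib

namespace FlipGraph

variable {V : Type*} {G : SimpleGraph V} {k : ℕ}

/-- The closed neighbourhood `N[v] = N(v) ∪ {v}`. -/
def closedNbhd (G : SimpleGraph V) (v : V) : Set V :=
  insert v (G.neighborSet v)

/-- `E_j(S)`: the edges of colour `j` in the subgraph induced by `S`, that is, the edges of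
colour `j` with both ends in `S`. The colours `1, …, k` are the elements `0, …, k - 1` of
`Fin k`. -/
def colourEdgesIn (C : G.edgeSet → Fin k) (j : Fin k) (S : Set V) : Set G.edgeSet :=
  {e | C e = j ∧ ∀ u ∈ (e : Sym2 V), u ∈ S}

/-- `e_j[v]`: the number of edges of colour `j` in the closed neighbourhood of `v`. -/
noncomputable def closedCount (C : G.edgeSet → Fin k) (j : Fin k) (v : V) : ℕ :=
  (colourEdgesIn C j (closedNbhd G v)).ncard

/-- `deg_j(v)`: the number of edges of colour `j` incident to `v`. -/
noncomputable def colourDegree (C : G.edgeSet → Fin k) (j : Fin k) (v : V) : ℕ :=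
  {e : G.edgeSet | C e = j ∧ v ∈ (e : Sym2 V)}.ncard

/-- `G` is an `(a_1, …, a_k)`-flip graph: `(a_j)` is an increasing sequence of positive integers
and some edge-colouring of `G` has every colour class `j` regular of degree `a_j`, while
`e_k[v] < ⋯ < e_1[v]` at every vertex `v`. (The entry `a_j` is `a i` with `i = j - 1`.) -/
def IsFlipGraph (G : SimpleGraph V) (a : Fin k → ℕ) : Prop :=
  (∀ j, 0 < a j) ∧ StrictMono a ∧
    ∃ C : G.edgeSet → Fin k,
      (∀ v j, colourDegree C j v = a j) ∧ ∀ v, StrictAnti fun j => closedCount C j v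

/-- `(a_1, …, a_k)` is a `k`-flip sequence: it is realised by a finite non-empty graph. -/
def IsFlipSequence (a : Fin k → ℕ) : Prop :=
  ∃ (V : Type) (_ : Finite V) (_ : Nonempty V) (G : SimpleGraph V), IsFlipGraph G a

/-- `1 ≤ q < k`, and for some `h` there are `k`-flip sequences with `a_q = h` and `a_k`
arbitrarily large. -/
def IsFreeIndex (k q : ℕ) : Prop :=
  ∃ (hq : 1 ≤ q) (hqk : q < k), ∃ h : ℕ, ∀ N : ℕ, ∃ a : Fin k → ℕ,
    IsFlipSequence a ∧ a ⟨q - 1, by omega⟩ = h ∧ N < a ⟨k - 1, by omega⟩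

/-- `q(k)`: the largest index `q < k` such that `a_q` can stay fixed while `a_k` is unbounded. -/
noncomputable def freeIndex (k : ℕ) : ℕ :=
  sSup {q | IsFreeIndex k q}

end FlipGraph

namespace FlipGraph

open Finset Classical

/-! The proof shows that `q` is free for `k` exactly when `1 ≤ q` and `3 * q < k`
(`isFreeIndex_iff`); all the stated bounds follow.

Necessity: mark the edges of the first `q` colours. If `k ≤ 3q`, the monotone closed counts make the
unmarked edges in each `N[v]` at most twice the marked ones. A triangle with `s` marked edges
satisfies `s - 1 ≤ s.choose 2`, so, summed over all vertices, the excess of marked links is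
controlled by the number of paths of two marked edges, that is, by the square of the marked degree.
Hence the marked degree bounds every other degree, and `a_k` cannot grow while `a_q` is fixed
(`sum_compl_degree_le`).

Sufficiency: Cartesian products add degrees and links, so gadgets can be superposed. The gadget is
`K_{D,D}` in an outer colour with each vertex blown up to a clique `K_m` in an inner colour: the
inner degree `m - 1` does not depend on `D`, yet the inner closed count grows like `D`, with ratio
to the outer one close to `1 : 2`. Using one gadget for each pair of an inner and an outer colour,
an inner colour occurs `k - q` times and an outer one `q` times, so the inner colours win once `k -
q > 2q` and `m` is large enough. -/

/-- The symmetric colour function of an edge-coloured graph; non-edges have no colour. -/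
noncomputable def pairColour {V : Type*} {G : SimpleGraph V} {k : ℕ} (C : G.edgeSet → Fin k)
    (u v : V) : Option (Fin k) :=
  if h : G.Adj u v then some (C ⟨s(u, v), h⟩) else none

/-- The number of neighbours of `v` along colour `j`. -/
noncomputable def pairDegree {V : Type*} [Fintype V] {k : ℕ} (c : V → V → Option (Fin k))
    (j : Fin k) (v : V) : ℕ :=
  #{w | c v w = some j}

/-- The number of ordered pairs of neighbours of `v` joined by an edge of colour `j`. -/
noncomputable def pairLinks {V : Type*} [Fintype V] {k : ℕ} (c : V → V → Option (Fin k))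
    (j : Fin k) (v : V) : ℕ :=
  #{p : V × V | c v p.1 ≠ none ∧ c v p.2 ≠ none ∧ c p.1 p.2 = some j}

/-! ### Edge colourings as symmetric colour functions -/

section Bridge

variable {V : Type*} {G : SimpleGraph V} {k : ℕ} (C : G.edgeSet → Fin k)

lemma pairColour_comm (u v : V) : pairColour C u v = pairColour C v u := by
  unfold pairColour
  by_cases h : G.Adj u v
  · have h' : G.Adj v u := h.symm
    have e : (⟨s(u, v), h⟩ : G.edgeSet) = ⟨s(v, u), h'⟩ := Subtype.ext Sym2.eq_swap
    simp only [h, h', dif_pos, e]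
  · have h' : ¬ G.Adj v u := fun h' => h h'.symm
    simp only [h, h', dif_neg, not_false_eq_true]

lemma pairColour_eq_some {u v : V} {j : Fin k} :
    pairColour C u v = some j ↔ ∃ h : G.Adj u v, C ⟨s(u, v), h⟩ = j := by
  unfold pairColour
  split_ifs with h <;> simp [h]

lemma pairColour_ne_none {u v : V} : pairColour C u v ≠ none ↔ G.Adj u v := by
  unfold pairColour
  split_ifs with h <;> simp [h]

lemma pairColour_self (v : V) : pairColour C v v = none := by
  simp [pairColour]

lemma colourDegree_eq [Fintype V] (j : Fin k) (v : V) :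
    colourDegree C j v = pairDegree (pairColour C) j v := by
  unfold colourDegree pairDegree
  rw [← Set.ncard_coe_finset]
  symm
  refine Set.ncard_congr
    (fun w hw => ⟨s(v, w), ((pairColour_eq_some C).1 (by simpa using hw)).1⟩) ?_ ?_ ?_
  · intro w hw
    obtain ⟨h, e⟩ := (pairColour_eq_some C).1 (by simpa using hw)
    exact ⟨e, by simp⟩
  · intro w w' _ _ h
    exact Sym2.congr_right.1 (congrArg Subtype.val h)
  · rintro ⟨e, he⟩ ⟨h1, h2⟩
    obtain ⟨w, rfl⟩ := Sym2.mem_iff_exists.1 h2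
    exact ⟨w, by simpa using (pairColour_eq_some C).2 ⟨he, h1⟩, rfl⟩

/-- The graph of the edges of colour `j` inside `S`. -/
def colourGraphIn (j : Fin k) (S : Set V) : SimpleGraph V where
  Adj x y := x ∈ S ∧ y ∈ S ∧ pairColour C x y = some j
  symm := ⟨fun x y h => ⟨h.2.1, h.1, by rw [pairColour_comm]; exact h.2.2⟩⟩
  loopless := ⟨fun x h => by simpa [pairColour_self] using h.2.2⟩

lemma ncard_colourEdgesIn (j : Fin k) (S : Set V) :
    (colourEdgesIn C j S).ncard = (colourGraphIn C j S).edgeSet.ncard := by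
  rw [← Set.ncard_image_of_injective _ Subtype.val_injective]
  congr 1
  ext e
  induction e with | _ x y
  constructor
  · rintro ⟨⟨e, he⟩, ⟨h1, h2⟩, rfl⟩
    exact ⟨h2 x (by simp), h2 y (by simp), (pairColour_eq_some C).2 ⟨he, h1⟩⟩
  · rintro ⟨hx, hy, h⟩
    obtain ⟨ha, hc⟩ := (pairColour_eq_some C).1 h
    refine ⟨⟨s(x, y), ha⟩, ⟨hc, fun u hu => ?_⟩, rfl⟩
    rcases Sym2.mem_iff.1 hu with rfl | rfl <;> assumption

lemma two_mul_ncard_edgeSet {V : Type*} [Fintype V] (H : SimpleGraph V) :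
    2 * H.edgeSet.ncard = #{p : V × V | H.Adj p.1 p.2} := by
  rw [← SimpleGraph.coe_edgeFinset, Set.ncard_coe_finset, ← H.sum_degrees_eq_twice_card_edges,
    card_filter, ← univ_product_univ, sum_product]
  refine sum_congr rfl fun v _ => ?_
  rw [← H.card_neighborFinset_eq_degree, ← card_filter]
  congr 1
  ext w
  simp

/-- An ordered edge inside `N[v]` starts at `v`, ends at `v`, or has both ends in `N(v)`; these
cases are disjoint. -/
lemma two_mul_closedCount [Fintype V] (j : Fin k) (v : V) :
    2 * closedCount C j v =
      2 * pairDegree (pairColour C) j v + pairLinks (pairColour C) j v := by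
  unfold closedCount
  rw [ncard_colourEdgesIn, two_mul_ncard_edgeSet]
  have hS : ∀ x, x ∈ closedNbhd G v ↔ x = v ∨ pairColour C v x ≠ none := fun x => by
    simp only [pairColour_ne_none]; rfl
  have h1 : pairDegree (pairColour C) j v =
      #{p : V × V | p.1 = v ∧ pairColour C p.1 p.2 = some j} := by
    refine card_bij (fun w _ => (v, w)) (by simp) (by simp) ?_
    rintro ⟨x, y⟩ h
    simp only [mem_filter, mem_univ, true_and] at h
    obtain ⟨rfl, h⟩ := h
    exact ⟨y, by simpa using h, rfl⟩
  have h2 : pairDegree (pairColour C) j v =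
      #{p : V × V | p.2 = v ∧ pairColour C p.1 p.2 = some j} := by
    refine card_bij (fun w _ => (w, v)) (by simp [pairColour_comm C _ v]) (by simp) ?_
    rintro ⟨x, y⟩ h
    simp only [mem_filter, mem_univ, true_and] at h
    obtain ⟨rfl, h⟩ := h
    exact ⟨x, by simpa [pairColour_comm C _ x] using h, rfl⟩
  have hn : ∀ {x y}, pairColour C x y = some j → pairColour C x y ≠ none := by
    intro x y h; simp [h]
  rw [two_mul]
  nth_rewrite 1 [h1]
  rw [h2, pairLinks, ← card_union_of_disjoint, ← card_union_of_disjoint]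
  · congr 1
    ext ⟨x, y⟩
    simp only [colourGraphIn, hS, mem_filter, mem_univ, true_and, mem_union]
    constructor
    · rintro ⟨rfl | hx, rfl | hy, h⟩ <;> tauto
    · rintro ((⟨rfl, h⟩ | ⟨rfl, h⟩) | ⟨hx, hy, h⟩)
      · exact ⟨Or.inl rfl, Or.inr (hn h), h⟩
      · exact ⟨Or.inr (by rw [pairColour_comm]; exact hn h), Or.inl rfl, h⟩
      · exact ⟨Or.inr hx, Or.inr hy, h⟩
  · rw [disjoint_left]
    rintro ⟨x, y⟩ h h'
    simp only [mem_filter, mem_univ, true_and, mem_union] at h h'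
    rcases h with ⟨rfl, h⟩ | ⟨rfl, h⟩
    · exact h'.1 (pairColour_self C _)
    · exact h'.2.1 (pairColour_self C _)
  · rw [disjoint_left]
    rintro ⟨x, y⟩ h h'
    simp only [mem_filter, mem_univ, true_and] at h h'
    obtain ⟨rfl, h⟩ := h
    obtain ⟨rfl, h'⟩ := h'
    simp [pairColour_self] at h

end Bridge

/-! ### Necessity: counting marked edges in triangles -/

/-- In a triangle whose edges are marked or not, the number of marked edges is at most one more
than the number of pairs of marked edges; summed over all vertices, this bounds the links that
are marked by the paths of two marked edges. -/
lemma three_mul_marked_links_le {V : Type*} [Fintype V] (t : V → V → V → ℤ) (α : V → V → ℤ)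
    (ht : ∀ x y z, t x y z = 0 ∨ t x y z = 1) (hα : ∀ x y, α x y = 0 ∨ α x y = 1)
    (hs : ∀ x y, α x y = α y x) (h12 : ∀ x y z, t x y z = t y x z)
    (h23 : ∀ x y z, t x y z = t x z y) :
    3 * (∑ v, ∑ x, ∑ y, t v x y * α x y) - ∑ v, ∑ x, ∑ y, t v x y ≤
      3 * ∑ v, (∑ x, α v x) ^ 2 := by
  have e1 : ∑ v, ∑ x, ∑ y, t v x y * α x y = ∑ v, ∑ x, ∑ y, t v x y * α v y := by
    rw [sum_comm]
    exact sum_congr rfl fun x _ => sum_congr rfl fun v _ => sum_congr rfl fun y _ => by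
      rw [h12]
  have e2 : ∑ v, ∑ x, ∑ y, t v x y * α v y = ∑ v, ∑ x, ∑ y, t v x y * α v x := by
    refine sum_congr rfl fun v _ => ?_
    rw [sum_comm]
    exact sum_congr rfl fun x _ => sum_congr rfl fun y _ => by rw [h23]
  have e3 : ∑ v, (∑ x, α v x) ^ 2 = ∑ v, ∑ x, ∑ y, α v x * α v y :=
    sum_congr rfl fun v _ => by rw [sq, sum_mul_sum]
  have f1 : ∑ v, ∑ x, ∑ y, α v x * α v y = ∑ v, ∑ x, ∑ y, α v x * α x y := by
    rw [sum_comm]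
    exact sum_congr rfl fun x _ => sum_congr rfl fun v _ => sum_congr rfl fun y _ => by
      rw [hs x v]
  have f2 : ∑ v, ∑ x, ∑ y, α v x * α x y = ∑ v, ∑ x, ∑ y, α v y * α x y := by
    refine sum_congr rfl fun v _ => ?_
    rw [sum_comm]
    exact sum_congr rfl fun x _ => sum_congr rfl fun y _ => by rw [hs y x]
  -- The inequality `s - 1 ≤ s.choose 2` for each ordered triple; off triangles the left side
  -- vanishes. By symmetry, the three terms on either side have equal sums.
  have key : ∑ v, ∑ x, ∑ y, (t v x y * α x y + t v x y * α v y + t v x y * α v x - t v x y) ≤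
      ∑ v, ∑ x, ∑ y, (α v x * α v y + α v x * α x y + α v y * α x y) := by
    refine sum_le_sum fun v _ => sum_le_sum fun x _ => sum_le_sum fun y _ => ?_
    rcases ht v x y with h | h <;> rcases hα v x with h1 | h1 <;> rcases hα v y with h2 | h2 <;>
      rcases hα x y with h3 | h3 <;> simp [h, h1, h2, h3]
  simp only [sum_sub_distrib, sum_add_distrib] at key
  rw [e3]
  linarith

lemma sum_ite_some_mem {k : ℕ} (A : Finset (Fin k)) (o : Option (Fin k)) :
    ∑ j ∈ A, (if o = some j then (1 : ℤ) else 0) = if ∃ j ∈ A, o = some j then 1 else 0 := by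
  cases o with
  | none => simp
  | some i => simp

variable {V : Type*} [Fintype V] {k : ℕ} (c : V → V → Option (Fin k))

lemma sum_pairDegree (A : Finset (Fin k)) (v : V) :
    ∑ j ∈ A, (pairDegree c j v : ℤ) = ∑ x, if ∃ j ∈ A, c v x = some j then 1 else 0 := by
  simp only [pairDegree, card_filter, Nat.cast_sum, Nat.cast_ite, Nat.cast_one, Nat.cast_zero]
  rw [sum_comm]
  exact sum_congr rfl fun x _ => sum_ite_some_mem A _

lemma sum_pairLinks (A : Finset (Fin k)) (v : V) :
    ∑ j ∈ A, (pairLinks c j v : ℤ) =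
      ∑ x, ∑ y, (if c v x ≠ none ∧ c v y ≠ none ∧ c x y ≠ none then 1 else 0) *
        if ∃ j ∈ A, c x y = some j then 1 else 0 := by
  simp only [pairLinks, card_filter, Nat.cast_sum, Nat.cast_ite, Nat.cast_one, Nat.cast_zero]
  rw [sum_comm, ← univ_product_univ, sum_product]
  refine sum_congr rfl fun x _ => sum_congr rfl fun y _ => ?_
  rw [← sum_ite_some_mem, mul_sum]
  refine sum_congr rfl fun j _ => ?_
  by_cases h : c x y = some j
  · simp [h]
  · simp [h]

/-- If at every vertex the colours in `A` have, in the weighting `2 : 1`, at least as many edges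
in the closed neighbourhood as the other colours, then the degrees in `A` bound the others. -/
lemma sum_compl_degree_le [Nonempty V] (hc : ∀ u v, c u v = c v u) (a : Fin k → ℕ)
    (ha : ∀ v j, pairDegree c j v = a j) (A : Finset (Fin k))
    (h : ∀ v, ∑ j ∈ Aᶜ, (2 * pairDegree c j v + pairLinks c j v) ≤
      2 * ∑ j ∈ A, (2 * pairDegree c j v + pairLinks c j v)) :
    ∑ j ∈ Aᶜ, a j ≤ 2 * ∑ j ∈ A, a j + 2 * (∑ j ∈ A, a j) ^ 2 := by
  set t : V → V → V → ℤ :=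
    fun v x y => if c v x ≠ none ∧ c v y ≠ none ∧ c x y ≠ none then 1 else 0 with ht
  set α : V → V → ℤ := fun x y => if ∃ j ∈ A, c x y = some j then 1 else 0 with hα
  have main := three_mul_marked_links_le t α
    (fun x y z => by simp only [ht]; split_ifs <;> simp)
    (fun x y => by simp only [hα]; split_ifs <;> simp)
    (fun x y => by simp only [hα, hc x y])
    (fun x y z => by simp only [ht, hc y x]; congr 1; ext; tauto)
    (fun x y z => by simp only [ht, hc z y]; congr 1; ext; tauto)
  have hA : ∀ v, ∑ x, α v x = ((∑ j ∈ A, a j : ℕ) : ℤ) := fun v => by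
    rw [← sum_pairDegree]; push_cast; simp only [ha]
  simp only [hA] at main
  have hall : ∀ v, ∑ j, (pairLinks c j v : ℤ) = ∑ x, ∑ y, t v x y := fun v => by
    rw [sum_pairLinks]
    refine sum_congr rfl fun x _ => sum_congr rfl fun y _ => ?_
    simp only [ht, mem_univ, true_and, ← Option.ne_none_iff_exists']
    by_cases h : c x y = none <;> simp [h]
  have hv : ∀ v, 2 * ((∑ j ∈ Aᶜ, a j : ℕ) : ℤ) + ∑ x, ∑ y, t v x y ≤
      4 * ((∑ j ∈ A, a j : ℕ) : ℤ) + 3 * ∑ x, ∑ y, t v x y * α x y := fun v => by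
    have h1 := h v
    simp only [ha, sum_add_distrib, ← mul_sum] at h1
    have h2 : ∑ j ∈ A, (pairLinks c j v : ℤ) = ∑ x, ∑ y, t v x y * α x y := sum_pairLinks c A v
    have h3 := sum_add_sum_compl A fun j => (pairLinks c j v : ℤ)
    zify at h1
    rw [hall] at h3
    push_cast
    linarith
  have hs := sum_le_sum fun v (_ : v ∈ (univ : Finset V)) => hv v
  simp only [sum_add_distrib, ← mul_sum, sum_const, card_univ, nsmul_eq_mul] at hs main
  have hn : (0 : ℤ) < Fintype.card V := by exact_mod_cast Fintype.card_pos
  zify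
  push_cast at hs main
  by_contra! hlt
  -- With `s` the degree in `A`, averaging gives `4 * s + 3 * s ^ 2` as a bound for twice the
  -- remaining degree; the 3 is rounded up to 4.
  nlinarith [mul_lt_mul_of_pos_left hlt hn, mul_nonneg hn.le (sq_nonneg (∑ j ∈ A, (a j : ℤ)))]

lemma IsFlipSequence.last_le {k q : ℕ} (hq : 1 ≤ q) (hqk : q < k) (h3 : k ≤ 3 * q)
    {a : Fin k → ℕ} (h : IsFlipSequence a) :
    a ⟨k - 1, by omega⟩ ≤
      2 * (q * a ⟨q - 1, by omega⟩) + 2 * (q * a ⟨q - 1, by omega⟩) ^ 2 := by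
  obtain ⟨V, _, _, G, -, hmono, C, hdeg, hanti⟩ := h
  have := Fintype.ofFinite V
  set r : Fin k := ⟨q - 1, by omega⟩ with hr
  set l : Fin k := ⟨k - 1, by omega⟩ with hl
  have hcard : #(Iic r) = q := by simp [hr]; omega
  have hcard' : #(Iic r)ᶜ = k - q := by rw [card_compl, hcard, Fintype.card_fin]
  have hsum : ∑ j ∈ Iic r, a j ≤ q * a r := by
    refine (sum_le_card_nsmul _ _ (a r) fun j hj => hmono.monotone (mem_Iic.1 hj)).trans ?_
    rw [hcard, smul_eq_mul]
  have hl_mem : l ∈ (Iic r)ᶜ := by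
    simp only [mem_compl, mem_Iic, not_le, hr, hl, Fin.mk_lt_mk]; omega
  have hlast : a l ≤ ∑ j ∈ (Iic r)ᶜ, a j := single_le_sum (fun _ _ => Nat.zero_le _) hl_mem
  refine hlast.trans ((sum_compl_degree_le (pairColour C) (pairColour_comm C) a
    (fun v j => by rw [← colourDegree_eq, hdeg]) (Iic r) fun v => ?_).trans ?_)
  · simp only [← two_mul_closedCount, ← mul_sum]
    have h1 : ∑ j ∈ (Iic r)ᶜ, closedCount C j v ≤ (k - q) * closedCount C r v := by
      rw [← hcard', ← smul_eq_mul]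
      refine sum_le_card_nsmul _ _ _ fun j hj => (hanti v).antitone ?_
      simp only [mem_compl, mem_Iic, not_le] at hj
      exact hj.le
    have h2 : q * closedCount C r v ≤ ∑ j ∈ Iic r, closedCount C j v := by
      nth_rewrite 1 [← hcard]
      rw [← smul_eq_mul]
      exact card_nsmul_le_sum _ _ _ fun j hj => (hanti v).antitone (mem_Iic.1 hj)
    -- Here `k ≤ 3 * q` enters: the later colours are at most twice as many as the first `q`.
    have h4 : (k - q) * closedCount C r v ≤ 2 * q * closedCount C r v :=
      Nat.mul_le_mul_right _ (by omega)
    linarith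
  · gcongr

lemma IsFreeIndex.three_mul_lt {k q : ℕ} (h : IsFreeIndex k q) : 3 * q < k := by
  obtain ⟨hq, hqk, b, hb⟩ := h
  by_contra! h3
  obtain ⟨a, ha, hab, hN⟩ := hb (2 * (q * b) + 2 * (q * b) ^ 2)
  have := ha.last_le hq hqk h3
  rw [hab] at this
  omega

/-! ### Realizable degrees and links; Cartesian products -/

/-- Some finite non-empty coloured graph has, at every vertex, `a j` neighbours along colour `j`
and `t j` ordered pairs of neighbours joined by an edge of colour `j`. -/
def Realizes {k : ℕ} (a t : Fin k → ℕ) : Prop :=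
  ∃ (V : Type) (_ : Fintype V) (_ : Nonempty V) (c : V → V → Option (Fin k)),
    (∀ u v, c u v = c v u) ∧ (∀ v, c v v = none) ∧
    (∀ v j, pairDegree c j v = a j) ∧ ∀ v j, pairLinks c j v = t j

lemma Realizes.isFlipSequence {k : ℕ} {a t : Fin k → ℕ} (h : Realizes a t)
    (hpos : ∀ j, 0 < a j) (hmono : StrictMono a) (hanti : StrictAnti fun j => 2 * a j + t j) :
    IsFlipSequence a := by
  obtain ⟨V, _, hV, c, hc, h0, ha, ht⟩ := h
  let G : SimpleGraph V :=
    { Adj := fun u v => (c u v).isSome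
      symm := ⟨fun u v h => by rw [hc]; exact h⟩
      loopless := ⟨fun v h => by simp [h0] at h⟩ }
  have hlift : ∀ e : G.edgeSet, (Sym2.lift ⟨c, hc⟩ (e : Sym2 V)).isSome := by
    rintro ⟨e, he⟩
    induction e with | _ x y
    exact he
  let C : G.edgeSet → Fin k := fun e => (Sym2.lift ⟨c, hc⟩ (e : Sym2 V)).get (hlift e)
  have hC : pairColour C = c := by
    funext u v
    by_cases h : G.Adj u v
    · simp only [pairColour, h, dif_pos]
      simp [C]
    · simp only [pairColour, h, dif_neg, not_false_eq_true]
      symm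
      simpa [G] using h
  refine ⟨V, inferInstance, hV, G, hpos, hmono, C, fun v j => ?_, fun v i j hij => ?_⟩
  · rw [colourDegree_eq, hC, ha]
  · have hi := two_mul_closedCount C i v
    have hj := two_mul_closedCount C j v
    rw [hC, ha, ht] at hi hj
    have := hanti hij
    simp only at this ⊢
    omega

lemma Realizes.zero {k : ℕ} : Realizes (0 : Fin k → ℕ) 0 :=
  ⟨Unit, inferInstance, inferInstance, fun _ _ => none, by simp, by simp,
    by simp [pairDegree], by simp [pairLinks]⟩

lemma Realizes.single {k : ℕ} (i : Fin k) : Realizes (Pi.single i 1) 0 := by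
  refine ⟨Bool, inferInstance, inferInstance, fun x y => if x = y then none else some i,
    fun x y => by simp [eq_comm], by simp, fun v j => ?_, fun v j => ?_⟩
  · by_cases h : i = j
    · subst h
      cases v <;> simp [pairDegree] <;> rfl
    · simp [pairDegree, h, Ne.symm h]
  · cases v <;> simp [pairLinks, Finset.filter_eq_empty_iff]

/-- The Cartesian product of two coloured graphs. -/
noncomputable def boxColour {V W : Type*} {k : ℕ} (c : V → V → Option (Fin k))
    (d : W → W → Option (Fin k)) (p q : V × W) : Option (Fin k) :=
  if p.2 = q.2 then c p.1 q.1 else if p.1 = q.1 then d p.2 q.2 else none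

lemma boxColour_ne_none {V W : Type*} {k : ℕ} {c : V → V → Option (Fin k)}
    {d : W → W → Option (Fin k)} (hd : ∀ w, d w w = none)
    {v x : V} {w y : W} :
    boxColour c d (v, w) (x, y) ≠ none ↔
      (y = w ∧ c v x ≠ none) ∨ (x = v ∧ d w y ≠ none) := by
  unfold boxColour
  by_cases hw : w = y
  · subst hw; simp [hd]
  · have hw' : ¬ y = w := Ne.symm hw
    by_cases hv : v = x
    · subst hv; simp [hw, hw']
    · have hv' : ¬ x = v := Ne.symm hv
      simp [hw, hv, hw', hv']

section Box

variable {V W : Type*} [Fintype V] [Fintype W] {k : ℕ} {c : V → V → Option (Fin k)}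
  {d : W → W → Option (Fin k)}

lemma pairDegree_boxColour (hc : ∀ v, c v v = none) (hd : ∀ w, d w w = none) (j : Fin k)
    (p : V × W) :
    pairDegree (boxColour c d) j p = pairDegree c j p.1 + pairDegree d j p.2 := by
  obtain ⟨v, w⟩ := p
  unfold pairDegree
  have : (univ.filter fun q : V × W => boxColour c d (v, w) q = some j) =
      (univ.filter fun x => c v x = some j).image (fun x => (x, w)) ∪
      (univ.filter fun y => d w y = some j).image (fun y => (v, y)) := by
    ext ⟨x, y⟩
    by_cases hw : w = y
    · subst hw
      by_cases hv : v = x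
      · subst hv; simp [boxColour, hc, hd]
      · simp [boxColour, hv]
    · have hw' : ¬ y = w := Ne.symm hw
      by_cases hv : v = x
      · subst hv; simp [boxColour, hw]
      · simp [boxColour, hw, hv]
  rw [this, card_union_of_disjoint, card_image_of_injective _ fun x y h => by simpa [Prod.ext_iff] using h,
    card_image_of_injective _ fun x y h => by simpa [Prod.ext_iff] using h]
  rw [disjoint_left]
  rintro ⟨x, y⟩ h1 h2
  simp only [mem_image, mem_filter, mem_univ, true_and, Prod.mk.injEq] at h1 h2
  obtain ⟨_, h1, rfl, rfl⟩ := h1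
  obtain ⟨_, h2, rfl, rfl⟩ := h2
  simp [hc] at h1

/-- Every triangle of a Cartesian product lies in a single fibre, so no mixed links arise. -/
lemma pairLinks_boxColour (hc : ∀ v, c v v = none) (hd : ∀ w, d w w = none) (j : Fin k)
    (p : V × W) :
    pairLinks (boxColour c d) j p = pairLinks c j p.1 + pairLinks d j p.2 := by
  obtain ⟨v, w⟩ := p
  unfold pairLinks
  have : (univ.filter fun q : (V × W) × (V × W) => boxColour c d (v, w) q.1 ≠ none ∧
        boxColour c d (v, w) q.2 ≠ none ∧ boxColour c d q.1 q.2 = some j) =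
      (univ.filter fun q : V × V => c v q.1 ≠ none ∧ c v q.2 ≠ none ∧ c q.1 q.2 = some j).image
        (fun q => ((q.1, w), (q.2, w))) ∪
      (univ.filter fun q : W × W => d w q.1 ≠ none ∧ d w q.2 ≠ none ∧ d q.1 q.2 = some j).image
        (fun q => ((v, q.1), (v, q.2))) := by
    ext ⟨⟨x, y⟩, ⟨x', y'⟩⟩
    simp only [mem_union, mem_image, mem_filter, mem_univ, true_and, Prod.mk.injEq, boxColour_ne_none hd, Prod.exists]
    constructor
    · rintro ⟨⟨rfl, h1⟩ | ⟨rfl, h1⟩, ⟨e, h2⟩ | ⟨e, h2⟩, h3⟩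
      · subst e
        exact Or.inl ⟨x, x', ⟨h1, h2, by simpa [boxColour] using h3⟩, by simp⟩
      · subst e
        have hx : x ≠ x' := by rintro rfl; exact h1 (hc _)
        have hy : y ≠ y' := by rintro rfl; exact h2 (hd _)
        simp [boxColour, hx, hy] at h3
      · subst e
        have hx : x ≠ x' := by rintro rfl; exact h2 (hc _)
        have hy : y ≠ y' := by rintro rfl; exact h1 (hd _)
        simp [boxColour, hx, hy] at h3
      · subst e
        refine Or.inr ⟨y, y', ⟨h1, h2, ?_⟩, by simp⟩
        by_cases hy : y = y'
        · simp [boxColour, hy, hc] at h3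
        · simpa [boxColour, hy] using h3
    · rintro (⟨z, z', ⟨h1, h2, h3⟩, ⟨rfl, rfl⟩, rfl, rfl⟩ | ⟨z, z', ⟨h1, h2, h3⟩, ⟨rfl, rfl⟩, rfl, rfl⟩)
      · exact ⟨Or.inl ⟨rfl, h1⟩, Or.inl ⟨rfl, h2⟩, by simpa [boxColour] using h3⟩
      · have hz : z ≠ z' := by rintro rfl; simp [hd] at h3
        exact ⟨Or.inr ⟨rfl, h1⟩, Or.inr ⟨rfl, h2⟩, by simpa [boxColour, hz] using h3⟩
  rw [this, card_union_of_disjoint, card_image_of_injective _ fun x y h => by simpa [Prod.ext_iff] using h,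
    card_image_of_injective _ fun x y h => by simpa [Prod.ext_iff] using h]
  rw [disjoint_left]
  rintro ⟨⟨x, y⟩, ⟨x', y'⟩⟩ h1 h2
  simp only [mem_image, mem_filter, mem_univ, true_and, Prod.mk.injEq, Prod.exists] at h1 h2
  obtain ⟨_, _, h1, ⟨rfl, rfl⟩, rfl, rfl⟩ := h1
  obtain ⟨_, _, h2, ⟨rfl, rfl⟩, rfl, rfl⟩ := h2
  exact h1.1 (hc _)

end Box

lemma Realizes.add {k : ℕ} {a t b s : Fin k → ℕ} (h : Realizes a t) (h' : Realizes b s) :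
    Realizes (a + b) (t + s) := by
  obtain ⟨V, _, _, c, hc, hc0, ha, ht⟩ := h
  obtain ⟨W, _, _, d, hd, hd0, hb, hs⟩ := h'
  refine ⟨V × W, inferInstance, inferInstance, boxColour c d, ?_, ?_, ?_, ?_⟩
  · rintro ⟨v, w⟩ ⟨x, y⟩
    simp [boxColour, hc v x, hd w y, eq_comm]
  · simp [boxColour, hc0]
  · intro p j
    rw [pairDegree_boxColour hc0 hd0, ha, hb, Pi.add_apply]
  · intro p j
    rw [pairLinks_boxColour hc0 hd0, ht, hs, Pi.add_apply]

lemma Realizes.sum {k : ℕ} {ι : Type*} (s : Finset ι) {a t : ι → Fin k → ℕ}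
    (h : ∀ i ∈ s, Realizes (a i) (t i)) : Realizes (∑ i ∈ s, a i) (∑ i ∈ s, t i) := by
  induction s using Finset.induction_on with
  | empty => simpa using Realizes.zero
  | insert i s hi ih =>
    rw [sum_insert hi, sum_insert hi]
    exact (h i (mem_insert_self i s)).add (ih fun x hx => h x (mem_insert_of_mem hx))

/-- A product of single edges is a hypercube, which has no triangles: degrees can be raised without
creating links. -/
lemma Realizes.of_degrees {k : ℕ} (p : Fin k → ℕ) : Realizes p 0 := by
  have h := Realizes.sum univ fun j (_ : j ∈ univ) =>
    Realizes.sum (range (p j)) fun _ _ => Realizes.single j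
  convert h using 1
  · funext j
    simp [Finset.sum_apply, Pi.single_apply]
  · simp

/-! ### Sufficiency: clique blow-ups -/

/-- The complete bipartite graph `K_{D,D}` in colour `b`, with every vertex replaced by a clique
`K_m` in colour `i`. -/
noncomputable def cliqueBlowup {k : ℕ} (D m : ℕ) (i b : Fin k)
    (x y : Bool × Fin D × Fin m) : Option (Fin k) :=
  if x.1 ≠ y.1 then some b else if x.2.1 = y.2.1 ∧ x.2.2 ≠ y.2.2 then some i else none

lemma card_filter_ne_ne {m : ℕ} (z : Fin m) :
    #{p : Fin m × Fin m | p.1 ≠ z ∧ p.2 ≠ z ∧ p.1 ≠ p.2} = (m - 1) * (m - 2) := by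
  rw [card_filter, ← univ_product_univ, sum_product]
  have : ∀ x : Fin m, (∑ y : Fin m, if x ≠ z ∧ y ≠ z ∧ x ≠ y then 1 else 0) =
      if x ≠ z then m - 2 else 0 := by
    intro x
    by_cases h : x = z
    · simp [h]
    · rw [← card_filter]
      have e : (univ.filter fun y => x ≠ z ∧ y ≠ z ∧ x ≠ y) = (univ.erase z).erase x := by
        ext y; simp [h, eq_comm, and_comm]
      rw [e, card_erase_of_mem (by simp [h]), card_erase_of_mem (mem_univ _)]
      simp [h]; omega
  simp only [this]
  rw [← sum_filter, sum_const, smul_eq_mul, filter_ne']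
  simp

lemma Realizes.cliqueBlowup {k : ℕ} {D m : ℕ} (hD : 0 < D) (hm : 0 < m) {i b : Fin k}
    (hib : i ≠ b) :
    Realizes (fun j => if j = i then m - 1 else if j = b then D * m else 0)
      (fun j => if j = i then (m - 1) * (m - 2) + D * (m * (m - 1))
        else if j = b then 2 * ((m - 1) * (D * m)) else 0) := by
  have : Nonempty (Fin D) := ⟨⟨0, hD⟩⟩
  have : Nonempty (Fin m) := ⟨⟨0, hm⟩⟩
  refine ⟨Bool × Fin D × Fin m, inferInstance, inferInstance, FlipGraph.cliqueBlowup D m i b,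
    ?_, ?_, ?_, ?_⟩
  · rintro ⟨e, s, x⟩ ⟨f, r, y⟩
    simp [FlipGraph.cliqueBlowup, eq_comm]
  · simp [FlipGraph.cliqueBlowup]
  · rintro ⟨e, s, x⟩ j
    by_cases hi : j = i
    · subst hi
      have : (univ.filter fun q => FlipGraph.cliqueBlowup D m j b (e, s, x) q = some j) =
          (univ.erase x).image (fun y => (e, s, y)) := by
        ext ⟨f, r, y⟩
        by_cases hf : e = f <;> simp [FlipGraph.cliqueBlowup, hf, hib.symm, eq_comm, and_comm]
      simp only [pairDegree, if_true]
      rw [this, card_image_of_injective _ fun x y h => by simpa using h,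
        card_erase_of_mem (mem_univ _), card_univ, Fintype.card_fin]
    · by_cases hb : j = b
      · subst hb
        have : (univ.filter fun q => FlipGraph.cliqueBlowup D m i j (e, s, x) q = some j) =
            univ.image (fun p => (!e, p)) := by
          ext ⟨f, r, y⟩
          cases e <;> cases f <;> simp [FlipGraph.cliqueBlowup, hib]
        simp only [pairDegree, if_true, if_neg hi]
        rw [this, card_image_of_injective _ fun x y h => by simpa using h, card_univ]
        simp
      · simp only [pairDegree, if_neg hi, if_neg hb, card_eq_zero, filter_eq_empty_iff]
        rintro ⟨f, r, y⟩ -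
        simp only [FlipGraph.cliqueBlowup]
        split_ifs <;> simp [Ne.symm hi, Ne.symm hb]
  · rintro ⟨e, s, x⟩ j
    by_cases hi : j = i
    · subst hi
      -- Inner links lie in the vertex's own clique or in one of the `D` cliques on the opposite
      -- side.
      have : (univ.filter fun q : (Bool × Fin D × Fin m) × (Bool × Fin D × Fin m) =>
            FlipGraph.cliqueBlowup D m j b (e, s, x) q.1 ≠ none ∧
            FlipGraph.cliqueBlowup D m j b (e, s, x) q.2 ≠ none ∧
            FlipGraph.cliqueBlowup D m j b q.1 q.2 = some j) =
          (univ.filter fun p : Fin m × Fin m => p.1 ≠ x ∧ p.2 ≠ x ∧ p.1 ≠ p.2).image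
            (fun p => ((e, s, p.1), (e, s, p.2))) ∪
          (univ ×ˢ univ.offDiag).image
            (fun p : Fin D × Fin m × Fin m => ((!e, p.1, p.2.1), (!e, p.1, p.2.2))) := by
        ext ⟨⟨f, r, y⟩, ⟨f', r', y'⟩⟩
        cases e <;> cases f <;> cases f' <;>
          simp [FlipGraph.cliqueBlowup, hib.symm] <;> grind
      simp only [pairLinks, if_true]
      rw [this, card_union_of_disjoint,
        card_image_of_injective _ fun x y h => by simpa [Prod.ext_iff] using h,
        card_image_of_injective _ fun x y h => by grind,
        card_filter_ne_ne, card_product, offDiag_card]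
      · simp [Nat.mul_sub]
      · rw [disjoint_left]
        rintro ⟨⟨f, r, y⟩, ⟨f', r', y'⟩⟩ h1 h2
        cases e <;> cases f <;> simp at h1 h2
    · by_cases hb : j = b
      · subst hb
        -- An outer link joins the vertex's own clique to the opposite side; the two orders give the
        -- factor 2.
        have : (univ.filter fun q : (Bool × Fin D × Fin m) × (Bool × Fin D × Fin m) =>
              FlipGraph.cliqueBlowup D m i j (e, s, x) q.1 ≠ none ∧
              FlipGraph.cliqueBlowup D m i j (e, s, x) q.2 ≠ none ∧
              FlipGraph.cliqueBlowup D m i j q.1 q.2 = some j) =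
            (univ.erase x ×ˢ univ).image
              (fun p : Fin m × Fin D × Fin m => ((e, s, p.1), (!e, p.2))) ∪
            (univ.erase x ×ˢ univ).image
              (fun p : Fin m × Fin D × Fin m => ((!e, p.2), (e, s, p.1))) := by
          ext ⟨⟨f, r, y⟩, ⟨f', r', y'⟩⟩
          cases e <;> cases f <;> cases f' <;>
            simp [FlipGraph.cliqueBlowup, hib] <;> grind
        simp only [pairLinks, if_true, if_neg hi]
        rw [this, card_union_of_disjoint,
          card_image_of_injective _ fun x y h => by simpa [Prod.ext_iff, and_assoc] using h,
          card_image_of_injective _ fun x y h => by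
            simpa [Prod.ext_iff, and_assoc, and_comm] using h,
          card_product, card_erase_of_mem (mem_univ _)]
        · simp [two_mul]
        · rw [disjoint_left]
          rintro ⟨⟨f, r, y⟩, ⟨f', r', y'⟩⟩ h1 h2
          cases e <;> cases f <;> simp at h1 h2
      · simp only [pairLinks, if_neg hi, if_neg hb, card_eq_zero, filter_eq_empty_iff]
        rintro ⟨⟨f, r, y⟩, ⟨f', r', y'⟩⟩ - ⟨-, -, h⟩
        simp only [FlipGraph.cliqueBlowup] at h
        split_ifs at h <;> simp_all

/-- The sum of clique blow-ups over all pairs of an inner colour in `A` and an outer colour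
not in `A`, padded by additional triangle-free edges. -/
lemma Realizes.sum_cliqueBlowup {k m : ℕ} (hm : 0 < m) (A : Finset (Fin k))
    (D : Fin k → Fin k → ℕ) (hD : ∀ i b, 0 < D i b) (p : Fin k → ℕ) :
    Realizes
      (fun j => p j + if j ∈ A then #Aᶜ * (m - 1) else m * ∑ i ∈ A, D i j)
      (fun j => if j ∈ A then #Aᶜ * ((m - 1) * (m - 2)) + m * (m - 1) * ∑ b ∈ Aᶜ, D j b
        else 2 * ((m - 1) * m) * ∑ i ∈ A, D i j) := by
  have hb : ∀ i ∈ A, ∀ b ∈ Aᶜ, i ≠ b := by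
    rintro i hi b hb rfl
    exact mem_compl.1 hb hi
  have h : Realizes _ _ := (Realizes.of_degrees p).add
    (Realizes.sum A.attach fun i _ => Realizes.sum Aᶜ.attach fun b _ =>
      Realizes.cliqueBlowup (hD i b) hm (hb i i.2 b b.2))
  have split : ∀ (f g : Fin k → Fin k → ℕ) (j : Fin k),
      (∑ i ∈ A, ∑ b ∈ Aᶜ, if j = i then f i b else if j = b then g i b else 0) =
      if j ∈ A then ∑ b ∈ Aᶜ, f j b else ∑ i ∈ A, g i j := by
    intro f g j
    split_ifs with hj
    · rw [sum_eq_single_of_mem j hj]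
      · simp
      · intro i _ hij
        refine sum_eq_zero fun b hb' => ?_
        simp [hij.symm, hb j hj b hb']
    · refine sum_congr rfl fun i hi => ?_
      have hji : j ≠ i := by
        rintro rfl
        exact hj hi
      simp [hji, hj]
  convert h using 1
  · funext j
    simp only [Pi.add_apply, Finset.sum_apply]
    rw [sum_attach A fun i => ∑ b ∈ Aᶜ.attach,
        if j = i then m - 1 else if j = b then D i b * m else 0]
    simp only [fun i => sum_attach Aᶜ fun b =>
        if j = i then m - 1 else if j = b then D i b * m else 0]
    rw [split (fun _ _ => m - 1) (fun i b => D i b * m), sum_const, smul_eq_mul, ← sum_mul,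
      mul_comm m]
  · funext j
    simp only [Pi.add_apply, Finset.sum_apply, Pi.zero_apply, zero_add]
    rw [sum_attach A fun i => ∑ b ∈ Aᶜ.attach,
        if j = i then (m - 1) * (m - 2) + D i b * (m * (m - 1))
        else if j = b then 2 * ((m - 1) * (D i b * m)) else 0]
    simp only [fun i => sum_attach Aᶜ fun b =>
        if j = i then (m - 1) * (m - 2) + D i b * (m * (m - 1))
        else if j = b then 2 * ((m - 1) * (D i b * m)) else 0]
    rw [split (fun i b => (m - 1) * (m - 2) + D i b * (m * (m - 1)))
      (fun i b => 2 * ((m - 1) * (D i b * m))), sum_add_distrib, sum_const, smul_eq_mul,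
      ← sum_mul, mul_comm (m * (m - 1))]
    congr 1
    rw [mul_sum]
    exact sum_congr rfl fun i _ => by ring

/-- The first `q` degrees are independent of `N`: the size parameter `K` enters only the outer
degrees. -/
lemma exists_isFlipSequence {k q : ℕ} (hq : 1 ≤ q) (h3 : 3 * q < k) (N : ℕ) :
    ∃ a : Fin k → ℕ, IsFlipSequence a ∧
      (∀ i : Fin k, (i : ℕ) < q → a i = i + (k - q) * (2 * q + 1)) ∧
      N < a ⟨k - 1, by omega⟩ := by
  obtain ⟨n, rfl⟩ : ∃ n, k = q + n := ⟨k - q, by omega⟩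
  set A : Finset (Fin (q + n)) := univ.filter fun i : Fin (q + n) => (i : ℕ) < q with hA
  have hmem : ∀ j, j ∈ A ↔ (j : ℕ) < q := by simp [hA]
  have hcA : #A = q := by
    rw [hA, Fin.card_filter_val_lt]; omega
  have hcB : #Aᶜ = n := by rw [card_compl, hcA, Fintype.card_fin]; omega
  -- A decreasing perturbation of the gadget sizes, which makes the links strictly decrease within
  -- each group of colours.
  set u : Fin (q + n) → ℕ := fun j => q + n - j with hu
  have hju : ∀ j : Fin (q + n), (j : ℕ) + u j = q + n := fun j => by simp only [hu]; omega
  set S := ∑ i ∈ A, u i with hS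
  set S' := ∑ i ∈ Aᶜ, u i with hS'
  -- The least `m` with `(2 * q + 1) * (m - 1) > 2 * q * m`, the comparison of leading terms when `n
  -- = 2 * q + 1`.
  set m := 2 * q + 2 with hm
  -- Large enough to exceed `N` and the inner degrees, and to absorb all terms of lower order in the
  -- comparison of closed counts.
  set K := N + 1 + n * (m - 1) + (q + n) + 2 * (q + n) + 2 * m * (q * (q + n) + S) +
    2 * ((m - 1) * m) * (q * (q + n) + S) with hK
  have h := Realizes.sum_cliqueBlowup (m := m) (by omega) A
    (fun i b => K + u i + u b) (fun i b => by omega)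
    -- The padding `q * m * j` cancels the decrease `q * m * u j` of the outer degrees up to a
    -- constant; the remaining `j` makes degrees strictly increase.
    (fun j => if j ∈ A then (j : ℕ) else (q * m + 1) * (j : ℕ))
  have e1 : ∀ j, ∑ i ∈ A, (K + u i + u j) = q * (K + u j) + S := fun j => by
    simp only [sum_add_distrib, sum_const, hcA, smul_eq_mul, ← hS]; ring
  have e2 : ∀ j, ∑ b ∈ Aᶜ, (K + u j + u b) = n * (K + u j) + S' := fun j => by
    simp only [sum_add_distrib, sum_const, hcB, smul_eq_mul, ← hS']; ring
  simp only [e1, e2, hcB, hmem] at h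
  obtain ⟨r, hr⟩ : ∃ r, n = 2 * q + 1 + r := ⟨n - (2 * q + 1), by omega⟩
  have hm1 : m - 1 = 2 * q + 1 := by omega
  have hm2 : m - 2 = 2 * q := by omega
  simp only [hm1, hm2] at h hK
  set W := m * (q * (K + (q + n)) + S) with hW
  have ha : (fun j : Fin (q + n) => (if (j : ℕ) < q then (j : ℕ) else (q * m + 1) * j) +
      if (j : ℕ) < q then n * (2 * q + 1) else m * (q * (K + u j) + S)) =
      fun j : Fin (q + n) => (j : ℕ) + if (j : ℕ) < q then n * (2 * q + 1) else W := by
    funext j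
    split_ifs
    · rfl
    · simp only [hW, ← hju j]; ring
  rw [ha] at h
  have hKW : K ≤ W := by
    calc K ≤ q * (K + (q + n)) + S := by nlinarith
      _ ≤ _ := Nat.le_mul_of_pos_left _ (by omega)
  refine ⟨_, h.isFlipSequence (fun j => ?_) (fun i j hij => ?_) (fun i j hij => ?_),
    fun i hi => ?_, ?_⟩
  · have : 0 < n * (2 * q + 1) := Nat.mul_pos (by omega) (by omega)
    split_ifs <;> omega
  · have hij' : (i : ℕ) < j := hij
    dsimp only
    split_ifs <;> omega
  · have hij' : (i : ℕ) < j := hij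
    obtain ⟨d, hd⟩ : ∃ d, (j : ℕ) = i + d := ⟨j - i, by omega⟩
    have hui : u i = u j + d := by have := hju i; have := hju j; omega
    have hd0 : 0 < d := by omega
    have hm4 : 4 ≤ m := by omega
    have hn3 : 3 ≤ n := by omega
    dsimp only
    split_ifs with hj hi hi
    · have h1 : 4 * 3 * 3 ≤ m * (2 * q + 1) * n := by gcongr; omega
      have h2 : 4 * 3 * 3 * d ≤ m * (2 * q + 1) * n * d := Nat.mul_le_mul_right _ h1
      rw [hui, hd]
      linarith
    · omega
    -- Inner against outer colour: the coefficients of `K` are at least `m * (2q + 1)^2` and exactly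
    -- `m * 2q * (2q + 2)`, leaving a margin of `m * K`.
    · have h1 : m * (2 * q + 1) * ((2 * q + 1) * K) ≤ m * (2 * q + 1) * (n * (K + u i) + S') :=
        Nat.mul_le_mul_left _ (le_trans (Nat.mul_le_mul (by omega) (by omega)) le_self_add)
      have h2 : 2 * ((2 * q + 1) * m) * (q * (K + u j) + S) ≤
          2 * ((2 * q + 1) * m) * (q * (K + (q + n)) + S) := by
        have := hju j
        gcongr
        omega
      have h3 : 2 * (q + n) + 2 * m * (q * (q + n) + S) +
          2 * ((2 * q + 1) * m) * (q * (q + n) + S) < K := by omega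
      have h4 : 1 * K ≤ m * K := Nat.mul_le_mul_right _ (by omega)
      have h5 : (j : ℕ) < q + n := j.2
      clear_value K m
      clear hK
      rw [hW]
      linarith [Nat.zero_le (i : ℕ), Nat.zero_le (n * (2 * q + 1)),
        Nat.zero_le (n * ((2 * q + 1) * (2 * q)))]
    · have h1 : 3 * 4 * 1 ≤ (2 * q + 1) * m * q := by gcongr; omega
      have h2 : 3 * 4 * 1 * d ≤ (2 * q + 1) * m * q * d := Nat.mul_le_mul_right _ h1
      rw [hui, hd]
      linarith
  · simp [hi]
  · dsimp only
    rw [if_neg (by omega)]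
    omega

/-! ### The exact range of free indices and the stated bounds -/

lemma isFreeIndex_iff {k q : ℕ} : IsFreeIndex k q ↔ 1 ≤ q ∧ 3 * q < k := by
  refine ⟨fun h => ⟨h.1, h.three_mul_lt⟩, fun ⟨hq, h3⟩ => ⟨hq, by omega,
    q - 1 + (k - q) * (2 * q + 1), fun N => ?_⟩⟩
  obtain ⟨a, ha, hp, hN⟩ := exists_isFlipSequence hq h3 N
  exact ⟨a, ha, hp ⟨q - 1, by omega⟩ (by simp only; omega), hN⟩

lemma isGreatest_freeIndex {k : ℕ} (hk : 3 < k) :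
    IsGreatest {q | IsFreeIndex k q} (freeIndex k) := by
  have hb : BddAbove {q | IsFreeIndex k q} := ⟨k, fun q ⟨_, h, _⟩ => h.le⟩
  exact ⟨Nat.sSup_mem ⟨1, isFreeIndex_iff.2 ⟨le_rfl, by omega⟩⟩ hb, fun q hq => le_csSup hb hq⟩

end FlipGraph

theorem theorem4p1 (k : ℕ) (hk : 3 < k) :
    IsGreatest {q | FlipGraph.IsFreeIndex k q} (FlipGraph.freeIndex k) ∧
    max 1 (⌈(k : ℚ) / 4⌉ - 1) ≤ (FlipGraph.freeIndex k : ℤ) ∧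
    (∀ q : ℕ, FlipGraph.IsFreeIndex k q →
      (q : ℚ) < if 3 ∣ k then (k : ℚ) / 3 else (⌈(k : ℚ) / 2⌉ : ℚ)) ∧
    (∀ q : ℕ, 1 ≤ q → (q = 1 ∨ (q : ℚ) < (k : ℚ) / 4) →
      ∃ p : Fin q → ℕ, ∀ N : ℕ, ∃ a : Fin k → ℕ,
        FlipGraph.IsFlipSequence a ∧
        (∀ (i : Fin k) (hi : (i : ℕ) < q), a i = p ⟨i, hi⟩) ∧
        N < a ⟨k - 1, by omega⟩) := by
  have hmax := FlipGraph.isGreatest_freeIndex hk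
  have h1 : 1 ≤ FlipGraph.freeIndex k := hmax.2 (FlipGraph.isFreeIndex_iff.2 ⟨le_rfl, by omega⟩)
  refine ⟨hmax, max_le (by exact_mod_cast h1) ?_, fun q hq => ?_, fun q hq hq' => ?_⟩
  · have hlt : ((⌈(k : ℚ) / 4⌉ - 1 : ℤ) : ℚ) < k / 4 := by
      push_cast
      linarith [Int.ceil_lt_add_one ((k : ℚ) / 4)]
    have hpos : 0 < ⌈(k : ℚ) / 4⌉ := Int.ceil_pos.2 (by positivity)
    obtain ⟨c, hc⟩ := Int.eq_ofNat_of_zero_le (a := ⌈(k : ℚ) / 4⌉ - 1) (by omega)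
    rw [hc] at hlt ⊢
    have h4 : 4 * c < k := by
      have : 4 * (c : ℚ) < k := by push_cast at hlt; linarith
      exact_mod_cast this
    -- The value `c = 0` is not an admissible index, but the bound is then trivial.
    rcases Nat.eq_zero_or_pos c with rfl | hc0
    · simp
    · exact_mod_cast hmax.2 (FlipGraph.isFreeIndex_iff.2 ⟨hc0, by omega⟩)
  · have h3 : 3 * (q : ℚ) < k := by exact_mod_cast (FlipGraph.isFreeIndex_iff.1 hq).2
    have hq0 : (0 : ℚ) ≤ q := Nat.cast_nonneg q
    split_ifs
    · linarith
    · linarith [Int.le_ceil ((k : ℚ) / 2)]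
  · have h3 : 3 * q < k := by
      rcases hq' with rfl | h
      · omega
      · have : 4 * (q : ℚ) < k := by linarith
        have : 4 * q < k := by exact_mod_cast this
        omega
    refine ⟨fun i => i + (k - q) * (2 * q + 1), fun N => ?_⟩
    obtain ⟨a, ha, hp, hN⟩ := FlipGraph.exists_isFlipSequence hq h3 N
    exact ⟨a, ha, hp, hN⟩
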